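/- **Theorem 2.1.** Let $m,k\ge 0$ and let $$G\cong \mathbf Z^{(m)}\oplus \mathbf Z_{n_1}\oplus\cdots\oplus \mathbf Z_{n_k}$$ be a finitely generated abelian group, where $n_1,\dots,n_k\ge 0$ are integers with $n_{i+1}\mid n_i$ for all $1\le i\le k-1$. Here $\mathbf Z_n=\mathbf Z/n\mathbf Z$ (so $\mathbf Z_0=\mathbf Z$), and $A^{(r)}$ denotes the direct sum of $r$ copies of $A$. Let $V$ be the set of words of the variety $\mathcal S_2$ of metabelian groups (groups with trivial second derived subgroup), that is, the words that are laws in every metabelian group. Let $1\to R\to F\to G\to 1$ be any free presentation of $G$ ($F$ a free group), and let $$\mathcal S_2M(G)=\frac{R\cap V(F)}{[RV^*F]}$$ be the metabelian multiplier of $G$ (the Baer invariant of $G$ with respect to $\mathcal S_2$), where $V(F)$ is the subgroup of $F$ generated by all values in $F$ of words in $V$, and $[RV^*F]$ is the subgroup of $F$ generated by all elements $$v(f_1,\dots,f_{i-1},f_ir,f_{i+1},\dots,f_s)\,v(f_1,\dots,f_s)^{-1},\qquad v\in V,\ s\in\mathbf N,\ 1\le i\le s,\ f_1,\dots,f_s\in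 F,\ r\in R.$$ Then $$\mathcal S_2M(G)\cong \mathbf Z^{(d_m)}\oplus \mathbf Z_{n_1}^{(d_{m+1}-d_m)}\oplus\cdots\oplus \mathbf Z_{n_k}^{(d_{m+k}-d_{m+k-1})},$$ where $d_i=\chi_2(\chi_2(i))$ and $\chi_n(d)=\frac1n\sum_{j\mid n}\mu(j)\,d^{\,n/j}$, with $\mu$ the Möbius function. Moreover, for every $i\ge 0$, $\chi_2(i)$ is the number of basic commutators of weight $2$ on $i$ letters. -/

import Mathlib

/-- The words (laws) of the variety of soluble groups of derived length at most `l`: all words in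
countably many variables that vanish identically in every such group.  (Testing on groups in
`Type` suffices, since the relatively free group on countably many letters lies there.) -/
def solvableWords (l : ℕ) : Set (FreeGroup ℕ) :=
  {w | ∀ (H : Type) [Group H], derivedSeries H l = ⊥ → ∀ f : ℕ → H, FreeGroup.lift f w = 1}

/-- The verbal subgroup `V(F)`: generated by all values in `F` of the words in `V`. -/
def verbalSubgroup (V : Set (FreeGroup ℕ)) (F : Type*) [Group F] : Subgroup F :=
  Subgroup.closure {x | ∃ w ∈ V, ∃ f : ℕ → F, x = FreeGroup.lift f w}

/-- The subgroup `[R V* F]`, generated by the elements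
`v(f₁, …, fᵢ r, …, fₙ) v(f₁, …, fᵢ, …, fₙ)⁻¹` with `v ∈ V`, `r ∈ R` and `fⱼ ∈ F`. -/
def starSubgroup (V : Set (FreeGroup ℕ)) {F : Type*} [Group F] (R : Subgroup F) : Subgroup F :=
  Subgroup.closure {x | ∃ w ∈ V, ∃ f : ℕ → F, ∃ i : ℕ, ∃ r ∈ R,
    x = FreeGroup.lift (Function.update f i (f i * r)) w * (FreeGroup.lift f w)⁻¹}

theorem conj_lift {F : Type*} [Group F] (g : F) (f : ℕ → F) (w : FreeGroup ℕ) :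
    g * FreeGroup.lift f w * g⁻¹ = FreeGroup.lift (fun j => g * f j * g⁻¹) w := by
  have h : (MulAut.conj g).toMonoidHom.comp (FreeGroup.lift f)
      = FreeGroup.lift (fun j => g * f j * g⁻¹) := by
    ext j
    simp
  simpa using DFunLike.congr_fun h w

instance starSubgroup_normal (V : Set (FreeGroup ℕ)) {F : Type*} [Group F] (R : Subgroup F)
    [hR : R.Normal] : (starSubgroup V R).Normal := by
  refine ⟨fun x hx g => ?_⟩
  have hle : (starSubgroup V R) ≤ (starSubgroup V R).comap (MulAut.conj g).toMonoidHom := by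
    refine (Subgroup.closure_le _).2 ?_
    rintro _ ⟨w, hw, f, i, r, hr, rfl⟩
    refine Subgroup.subset_closure ⟨w, hw, fun j => g * f j * g⁻¹, i, g * r * g⁻¹,
      hR.conj_mem r hr g, ?_⟩
    have h1 : (fun j => g * Function.update f i (f i * r) j * g⁻¹)
        = Function.update (fun j => g * f j * g⁻¹) i (g * f i * g⁻¹ * (g * r * g⁻¹)) := by
      funext j
      by_cases hj : j = i
      · subst hj
        simp [mul_assoc]
      · simp [hj]
    rw [← h1, ← conj_lift, ← conj_lift]
    simp [mul_assoc]
  simpa using hle hx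

/-- The denominator of the Baer invariant is contained in the numerator. -/
theorem starSubgroup_le (V : Set (FreeGroup ℕ)) {F : Type*} [Group F] (R : Subgroup F)
    [R.Normal] : starSubgroup V R ≤ R ⊓ verbalSubgroup V F := by
  refine (Subgroup.closure_le _).2 ?_
  rintro _ ⟨w, hw, f, i, r, hr, rfl⟩
  refine Subgroup.mem_inf.2 ⟨?_, mul_mem (Subgroup.subset_closure ⟨w, hw, _, rfl⟩)
    (inv_mem (Subgroup.subset_closure ⟨w, hw, _, rfl⟩))⟩
  have h : (QuotientGroup.mk' R).comp (FreeGroup.lift (Function.update f i (f i * r)))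
      = (QuotientGroup.mk' R).comp (FreeGroup.lift f) := by
    ext j
    by_cases hj : j = i
    · subst hj
      simpa using hr
    · simp [hj]
  have h2 := DFunLike.congr_fun h w
  simp only [MonoidHom.comp_apply] at h2
  rw [← QuotientGroup.ker_mk' R, MonoidHom.mem_ker, map_mul, map_inv, h2,
    mul_inv_cancel]

/-- The Baer invariant `(R ∩ V(F)) / [R V* F]` computed from a presentation `π : F → G` with
kernel `R`, where `V` is the set of words of the variety. -/
abbrev BaerInvariant (V : Set (FreeGroup ℕ)) {F G : Type*} [Group F] [Group G] (π : F →* G) :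
    Type _ :=
  ↥(π.ker ⊓ verbalSubgroup V F) ⧸
    (starSubgroup V π.ker).subgroupOf (π.ker ⊓ verbalSubgroup V F)

/-- The order on formal commutators over an ordered alphabet: first by weight (the number of
letters), and lexicographically among commutators of equal weight. -/
def commLT {α : Type*} [LT α] : FreeMagma α → FreeMagma α → Prop
  | .of a, .of b => a < b
  | .of _, .mul _ _ => True
  | .mul _ _, .of _ => False
  | .mul x y, .mul x' y' =>
      (x.length + y.length < x'.length + y'.length) ∨
      (x.length + y.length = x'.length + y'.length ∧ (commLT x x' ∨ (x = x' ∧ commLT y y')))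

/-- Basic commutators: letters, and `[b, a]` with `b`, `a` basic, `a < b`, and `b₂ ≤ a` whenever
`b = [b₁, b₂]`.  The commutator `[b, a]` is the product `b * a` in the free magma. -/
def IsBasicComm {α : Type*} [LT α] : FreeMagma α → Prop
  | .of _ => True
  | .mul b a => IsBasicComm b ∧ IsBasicComm a ∧ commLT a b ∧
      ∀ b₁ b₂, b = .mul b₁ b₂ → (commLT b₂ a ∨ b₂ = a)

/-- The number of basic commutators of weight `n` on `d` letters. -/
noncomputable def numBasicComm (n d : ℕ) : ℕ :=
  Nat.card {w : FreeMagma (Fin d) // IsBasicComm w ∧ w.length = n}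

/-- The Witt number `χ_n(d) = (1/n) ∑_{m ∣ n} μ(m) d^{n/m}` (a natural number for `n ≥ 1`). -/
def wittNumber (n d : ℕ) : ℕ :=
  ((∑ m ∈ n.divisors, ArithmeticFunction.moebius m * (d : ℤ) ^ (n / m)) / (n : ℤ)).toNat

/-- `d_i = χ₂(χ₂(i))`. -/
def dNumber (i : ℕ) : ℕ := wittNumber 2 (wittNumber 2 i)

/-! Write `F'` for the commutator subgroup of `F` and `R` for the kernel of `π`. For metabelian
words, `V(F) = ⁅F', F'⁆` and `[RV*F] = ⁅⁅R, F⁆, F'⁆`. Since `G` is abelian, `F' ≤ R`, so the Baer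
invariant is `⁅F', F'⁆ / ⁅⁅R, F⁆, F'⁆`.

Hopf's formula (`exists_commutator_hom`) says that for a free group `K` and a surjection onto an
abelian group `A` with kernel `N`, `⁅K, K⁆ / ⁅N, K⁆` is the exterior square of `A`. With `K = F` it
gives `F' / ⁅R, F⁆ ≅ Λ²G`. By Nielsen–Schreier `F'` is free, so the formula applies again with `K =
F'` and `N = ⁅R, F⁆`, and the invariant is `Λ²(Λ²G)`.

The exterior square of `∏ ZMod (a i)` is the product of `ZMod (gcd (a i) (a j))` over `i < j`
(`isExteriorSquare_wedge`). Along a divisibility chain the gcd is the order at the later index, so a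
pair takes the maximum of the two levels. Hence if `c` factors have level below `t`, the exterior
square has `c.choose 2` such factors. Starting from `t` and iterating twice gives `d_t`; differences
of consecutive `d_t` are the multiplicities. -/

open scoped commutatorElement IsMulCommutative

/-! ### Commutator subgroups of generated subgroups and congruent homomorphisms -/

open Subgroup in
/-- To bound the commutator subgroup of two generated subgroups by a normal subgroup, it suffices
to consider commutators of generators. -/
theorem commutator_closure_le {G : Type*} [Group G] {N : Subgroup G} [hN : N.Normal] {S T : Set G}
    (h : ∀ s ∈ S, ∀ t ∈ T, ⁅s, t⁆ ∈ N) : ⁅closure S, closure T⁆ ≤ N := by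
  -- Centralizers modulo `N` are subgroups, so the condition passes from generators to the closure,
  -- one argument at a time.
  have key : ∀ a b : G, ⁅a, b⁆ ∈ N ↔
      (QuotientGroup.mk' N b) ∈ centralizer {QuotientGroup.mk' N a} := by
    intro a b
    have h1 : ⁅a, b⁆ ∈ N ↔ QuotientGroup.mk' N ⁅a, b⁆ = 1 := by
      rw [← MonoidHom.mem_ker, QuotientGroup.ker_mk']
    rw [h1, mem_centralizer_singleton_iff, map_commutatorElement,
      commutatorElement_eq_one_iff_mul_comm]
    exact eq_comm
  have symm : ∀ a b : G, ⁅a, b⁆ ∈ N ↔ ⁅b, a⁆ ∈ N := fun a b => by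
    rw [← inv_mem_iff, commutatorElement_inv]
  have step : ∀ (U : Set G) (a : G), (∀ u ∈ U, ⁅a, u⁆ ∈ N) → ∀ u ∈ closure U, ⁅a, u⁆ ∈ N := by
    intro U a hU u hu
    have : closure U ≤ (centralizer {QuotientGroup.mk' N a}).comap (QuotientGroup.mk' N) :=
      (closure_le _).2 fun v hv => (key a v).1 (hU v hv)
    exact (key a u).2 (this hu)
  refine commutator_le.2 fun s hs t ht => step T s (fun t ht => ?_) t ht
  exact (symm _ _).1 (step S t (fun s hs => (symm _ _).1 (h s hs t ht)) s hs)

open Subgroup in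
/-- Two homomorphisms which agree modulo `M` on `D` and map `D` into `T` agree modulo `⁅M, T⁆` on
`⁅D, D⁆`. -/
theorem agree_on_commutator {K H : Type*} [Group K] [Group H] (α β : K →* H) (D : Subgroup K)
    (M T : Subgroup H) [M.Normal] [T.Normal] (hMT : M ≤ T)
    (hβ : ∀ x ∈ D, β x ∈ T) (h : ∀ x ∈ D, α x * (β x)⁻¹ ∈ M) :
    ∀ x ∈ ⁅D, D⁆, α x * (β x)⁻¹ ∈ ⁅M, T⁆ := by
  set q := QuotientGroup.mk' ⁅M, T⁆ with hq
  have hker : ∀ z, z ∈ ⁅M, T⁆ ↔ q z = 1 := fun z => by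
    rw [hq, ← MonoidHom.mem_ker, QuotientGroup.ker_mk']
  have hc : ∀ c ∈ M, ∀ t ∈ T, q c * q t = q t * q c := fun c hc t ht => by
    rw [← commutatorElement_eq_one_iff_mul_comm, ← map_commutatorElement, ← hker]
    exact commutator_mem_commutator hc ht
  -- Modulo `⁅M, T⁆` the discrepancies `c, d ∈ M` between `α` and `β` commute with `T`, which
  -- contains `M`; so they cancel from each commutator.
  have hle : ⁅D, D⁆ ≤ (q.comp α).eqLocus (q.comp β) := by
    refine commutator_le.2 fun x hx y hy => ?_
    obtain ⟨c, hcM, hcx⟩ : ∃ c ∈ M, α x = c * β x := ⟨_, h x hx, by simp⟩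
    obtain ⟨d, hdM, hdy⟩ : ∃ d ∈ M, α y = d * β y := ⟨_, h y hy, by simp⟩
    change q (α ⁅x, y⁆) = q (β ⁅x, y⁆)
    have cx := hc c hcM _ (hβ x hx)
    have cy := hc c hcM _ (hβ y hy)
    have dx := hc d hdM _ (hβ x hx)
    have dy := hc d hdM _ (hβ y hy)
    have cd := hc c hcM d (hMT hdM)
    have e2 : Commute (q d) (q (β x)) := dx
    simp only [map_commutatorElement, hcx, hdy, map_mul]
    have s1 : ⁅q c * q (β x), q d * q (β y)⁆ = ⁅q (β x), q d * q (β y)⁆ := by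
      have hy' : Commute (q c) (q d * q (β y)) := Commute.mul_right cd cy
      have hx' : Commute (q c) (q (β x)) := cx
      calc ⁅q c * q (β x), q d * q (β y)⁆
          = q c * (q (β x) * (q d * q (β y)) * (q (β x))⁻¹) * (q c)⁻¹ * (q d * q (β y))⁻¹ := by
            rw [commutatorElement_def]; group
        _ = _ := by
            rw [((hx'.mul_right hy').mul_right hx'.inv_right).eq, commutatorElement_def]; group
    have s2 : ⁅q (β x), q d * q (β y)⁆ = ⁅q (β x), q (β y)⁆ := by
      calc ⁅q (β x), q d * q (β y)⁆
          = q (β x) * q d * q (β y) * (q (β x))⁻¹ * (q (β y))⁻¹ * (q d)⁻¹ := by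
            rw [commutatorElement_def]; group
        _ = q d * ⁅q (β x), q (β y)⁆ * (q d)⁻¹ := by
            rw [← e2.eq, commutatorElement_def]; group
        _ = _ := by
            have hy' : Commute (q d) (q (β y)) := dy
            have : Commute (q d) ⁅q (β x), q (β y)⁆ := by
              rw [commutatorElement_def]
              exact ((e2.mul_right hy').mul_right e2.inv_right).mul_right hy'.inv_right
            rw [this.eq]; group
    rw [s1, s2]
  intro x hx
  rw [hker, map_mul, map_inv]
  exact mul_inv_eq_one.2 (hle hx)

/-! ### Verbal and star subgroups of the metabelian variety -/

theorem mem_solvableWords_iff (l : ℕ) (w : FreeGroup ℕ) :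
    w ∈ solvableWords l ↔ w ∈ derivedSeries (FreeGroup ℕ) l := by
  constructor
  · intro hw
    -- The relatively free group of countable rank detects every law.
    have hbot : derivedSeries (FreeGroup ℕ ⧸ derivedSeries (FreeGroup ℕ) l) l = ⊥ := by
      rw [← map_derivedSeries_eq (QuotientGroup.mk'_surjective _), Subgroup.map_eq_bot_iff,
        QuotientGroup.ker_mk']
    have h := hw _ hbot fun i => QuotientGroup.mk' _ (FreeGroup.of i)
    have e : FreeGroup.lift (fun i => QuotientGroup.mk' (derivedSeries (FreeGroup ℕ) l)
        (FreeGroup.of i)) = QuotientGroup.mk' _ := by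
      ext i; simp
    rwa [e, ← MonoidHom.mem_ker, QuotientGroup.ker_mk'] at h
  · intro hw H _ hH f
    have h := map_derivedSeries_le_derivedSeries (FreeGroup.lift f) l
      (Subgroup.mem_map_of_mem _ hw)
    rwa [hH, Subgroup.mem_bot] at h

theorem derivedSeries_two (G : Type*) [Group G] :
    derivedSeries G 2 = ⁅commutator G, commutator G⁆ := by
  rw [derivedSeries_succ, derivedSeries_one]

/-- The word `[[x₀, x₁], [x₂, x₃]]`. -/
def metabelianWord : FreeGroup ℕ :=
  ⁅⁅FreeGroup.of 0, FreeGroup.of 1⁆, ⁅FreeGroup.of 2, FreeGroup.of 3⁆⁆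

theorem metabelianWord_mem : metabelianWord ∈ solvableWords 2 := by
  rw [mem_solvableWords_iff, derivedSeries_two]
  exact Subgroup.commutator_mem_commutator
    (Subgroup.commutator_mem_commutator (Subgroup.mem_top _) (Subgroup.mem_top _))
    (Subgroup.commutator_mem_commutator (Subgroup.mem_top _) (Subgroup.mem_top _))

/-- The substitution of four elements for the first four letters. -/
def fourLetters {G : Type*} [Group G] (a b c d : G) : ℕ → G
  | 0 => a
  | 1 => b
  | 2 => c
  | 3 => d
  | _ => 1

theorem lift_metabelianWord {G : Type*} [Group G] (f : ℕ → G) :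
    FreeGroup.lift f metabelianWord = ⁅⁅f 0, f 1⁆, ⁅f 2, f 3⁆⁆ := by
  simp [metabelianWord, map_commutatorElement]

instance verbalSubgroup_normal (V : Set (FreeGroup ℕ)) (F : Type*) [Group F] :
    (verbalSubgroup V F).Normal := by
  refine ⟨fun x hx g => ?_⟩
  have hle : verbalSubgroup V F ≤ (verbalSubgroup V F).comap (MulAut.conj g).toMonoidHom := by
    refine (Subgroup.closure_le _).2 ?_
    rintro _ ⟨w, hw, f, rfl⟩
    exact Subgroup.subset_closure ⟨w, hw, _, conj_lift g f w⟩
  simpa using hle hx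

theorem verbalSubgroup_solvableWords_two (F : Type*) [Group F] :
    verbalSubgroup (solvableWords 2) F = ⁅commutator F, commutator F⁆ := by
  apply le_antisymm
  · refine (Subgroup.closure_le _).2 ?_
    rintro _ ⟨w, hw, f, rfl⟩
    rw [mem_solvableWords_iff] at hw
    rw [← derivedSeries_two]
    exact map_derivedSeries_le_derivedSeries (FreeGroup.lift f) 2 (Subgroup.mem_map_of_mem _ hw)
  · rw [commutator_eq_closure]
    refine commutator_closure_le ?_
    rintro _ ⟨a, b, rfl⟩ _ ⟨c, d, rfl⟩
    exact Subgroup.subset_closure ⟨_, metabelianWord_mem, fourLetters a b c d,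
      (lift_metabelianWord (fourLetters a b c d)).symm⟩

/-- Substitutions congruent modulo `R` agree modulo `⁅R, F⁆` on first commutators, hence modulo
`⁅⁅R, F⁆, F'⁆` on the second derived subgroup, where the words live. Conversely, one metabelian word
produces all the generating commutators. -/
theorem starSubgroup_solvableWords_two {F : Type*} [Group F] (R : Subgroup F) [R.Normal] :
    starSubgroup (solvableWords 2) R = ⁅⁅R, (⊤ : Subgroup F)⁆, commutator F⁆ := by
  apply le_antisymm
  · refine (Subgroup.closure_le _).2 ?_
    rintro _ ⟨w, hw, f, i, r, hr, rfl⟩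
    rw [mem_solvableWords_iff, derivedSeries_two] at hw
    set α := FreeGroup.lift (Function.update f i (f i * r))
    set β := FreeGroup.lift f
    have h0 : ∀ x, α x * (β x)⁻¹ ∈ R := by
      have h : (QuotientGroup.mk' R).comp α = (QuotientGroup.mk' R).comp β := by
        ext j
        by_cases hj : j = i
        · subst hj
          simpa [α, β] using hr
        · simp [α, β, hj]
      intro x
      have h2 := DFunLike.congr_fun h x
      simp only [MonoidHom.comp_apply] at h2
      rw [← QuotientGroup.ker_mk' R, MonoidHom.mem_ker, map_mul, map_inv, h2, mul_inv_cancel]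
    have h1 := agree_on_commutator α β ⊤ R ⊤ le_top (fun _ _ => Subgroup.mem_top _)
      (fun x _ => h0 x)
    have hβ : ∀ x ∈ commutator (FreeGroup ℕ), β x ∈ commutator F := fun x hx => by
      have h := map_derivedSeries_le_derivedSeries β 1
      rw [derivedSeries_one, derivedSeries_one] at h
      exact h (Subgroup.mem_map_of_mem _ hx)
    exact agree_on_commutator α β (commutator _) ⁅R, (⊤ : Subgroup F)⁆ (commutator F)
      (Subgroup.commutator_mono le_top le_rfl) hβ h1 w hw
  · rw [commutator_eq_closure, Subgroup.commutator_def R]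
    refine commutator_closure_le ?_
    rintro _ ⟨r, hr, b, -, rfl⟩ _ ⟨c, d, rfl⟩
    -- Putting `1` in the perturbed slot makes the unperturbed value trivial, which leaves exactly
    -- `⁅⁅r, b⁆, ⁅c, d⁆⁆`.
    refine Subgroup.subset_closure ⟨_, metabelianWord_mem, fourLetters 1 b c d, 0, r, hr, ?_⟩
    rw [lift_metabelianWord, lift_metabelianWord]
    simp [fourLetters]

/-! ### Exterior squares and cocycle extensions -/

/-- An alternating biadditive map which every alternating biadditive map factors through, and whose
values generate its target; that is, a model of the exterior square of `A`. -/
structure IsExteriorSquare.{u, v, w} {A : Type v} {B : Type w} [AddCommGroup A] [AddCommGroup B]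
    (ω : A →+ A →+ B) : Prop where
  alternating : ∀ a, ω a a = 0
  closure_eq_top : AddSubgroup.closure {b | ∃ x y, ω x y = b} = ⊤
  exists_lift : ∀ (C : Type u) [AddCommGroup C] (f : A →+ A →+ C), (∀ a, f a a = 0) →
    ∃ g : B →+ C, ∀ x y, g (ω x y) = f x y

theorem alternating_swap {A B : Type*} [AddCommGroup A] [AddCommGroup B] {ω : A →+ A →+ B}
    (h : ∀ a, ω a a = 0) (x y : A) : ω x y = -ω y x := by
  have := h (x + y)
  simp only [map_add, AddMonoidHom.add_apply, h, zero_add, add_zero] at this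
  exact eq_neg_of_add_eq_zero_right this

/-- The central extension of `A` by `B` defined by a biadditive cocycle. -/
@[ext]
structure CocycleExt {A B : Type*} [AddCommGroup A] [AddCommGroup B] (β : A →+ A →+ B) where
  base : A
  fiber : B

namespace CocycleExt

variable {A B : Type*} [AddCommGroup A] [AddCommGroup B] {β : A →+ A →+ B}

instance : Mul (CocycleExt β) := ⟨fun x y => ⟨x.base + y.base, x.fiber + y.fiber + β x.base y.base⟩⟩
instance : One (CocycleExt β) := ⟨⟨0, 0⟩⟩
instance : Inv (CocycleExt β) := ⟨fun x => ⟨-x.base, -x.fiber + β x.base x.base⟩⟩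

@[simp] theorem mul_base (x y : CocycleExt β) : (x * y).base = x.base + y.base := rfl
@[simp] theorem mul_fiber (x y : CocycleExt β) :
    (x * y).fiber = x.fiber + y.fiber + β x.base y.base := rfl
@[simp] theorem one_base : (1 : CocycleExt β).base = 0 := rfl
@[simp] theorem one_fiber : (1 : CocycleExt β).fiber = 0 := rfl
@[simp] theorem inv_base (x : CocycleExt β) : (x⁻¹).base = -x.base := rfl
@[simp] theorem inv_fiber (x : CocycleExt β) : (x⁻¹).fiber = -x.fiber + β x.base x.base := rfl

instance : Group (CocycleExt β) :=
  Group.ofLeftAxioms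
    (fun x y z => by
      ext <;> simp only [mul_base, mul_fiber, map_add, AddMonoidHom.add_apply] <;> abel)
    (fun x => by ext <;> simp)
    (fun x => by ext <;> simp)

theorem commutator_base (x y : CocycleExt β) : (⁅x, y⁆ : CocycleExt β).base = 0 := by
  simp only [commutatorElement_def, mul_base, inv_base]; abel

/-- A commutator depends only on the base components and sees only the antisymmetrization of the
cocycle, so a prescribed alternating form can be realized by commutators. -/
theorem commutator_fiber (x y : CocycleExt β) :
    (⁅x, y⁆ : CocycleExt β).fiber = β x.base y.base - β y.base x.base := by
  simp only [commutatorElement_def, mul_base, mul_fiber, inv_base, inv_fiber, map_add, map_neg,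
    AddMonoidHom.add_apply, AddMonoidHom.neg_apply]
  abel

/-- The projection onto the base. -/
def baseHom (β : A →+ A →+ B) : CocycleExt β →* Multiplicative A where
  toFun x := Multiplicative.ofAdd x.base
  map_one' := rfl
  map_mul' _ _ := rfl

end CocycleExt

/-- An alternating form on `A`, pulled back to a free abelian group, is the antisymmetrization of
a biadditive form. -/
theorem exists_biadditive_sub_eq {X A B : Type*} [AddCommGroup A] [AddCommGroup B]
    {ω : A →+ A →+ B} (h : ∀ a, ω a a = 0) (q : FreeAbelianGroup X →+ A) :
    ∃ β : FreeAbelianGroup X →+ FreeAbelianGroup X →+ B,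
      ∀ x y, β x y - β y x = ω (q x) (q y) := by
  classical
  -- Any linear order on the basis will do: `β` keeps the values of the form on increasing pairs,
  -- and antisymmetrizing recovers the rest.
  let _ : LinearOrder X := linearOrderOfSTO WellOrderingRel
  let β : FreeAbelianGroup X →+ FreeAbelianGroup X →+ B :=
    FreeAbelianGroup.lift fun i => FreeAbelianGroup.lift fun j =>
      if i < j then ω (q (.of i)) (q (.of j)) else 0
  refine ⟨β, fun x y => ?_⟩
  have e : β - β.flip = (ω.comp q).compl₂ q := by
    refine FreeAbelianGroup.lift_ext _ _ fun i => FreeAbelianGroup.lift_ext _ _ fun j => ?_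
    simp only [AddMonoidHom.sub_apply, AddMonoidHom.flip_apply, AddMonoidHom.compl₂_apply,
      AddMonoidHom.comp_apply, β, FreeAbelianGroup.lift_apply_of]
    rcases lt_trichotomy i j with hij | rfl | hij
    · simp [hij, hij.not_gt]
    · simp [h]
    · simp [hij, hij.not_gt, alternating_swap h (q (.of i))]
  exact DFunLike.congr_fun (DFunLike.congr_fun e x) y

/-! ### Hopf's formula for abelian quotients -/

open Subgroup in
/-- The commutator form of a group which is central modulo `N` descends to any abelian quotient. -/
theorem exists_commutator_form {K A : Type*} [Group K] [AddCommGroup A]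
    (p : K →* Multiplicative A) (hp : Function.Surjective p) :
    ∃ f : A →+ A →+ Additive (center (K ⧸ ⁅p.ker, (⊤ : Subgroup K)⁆)), (∀ a, f a a = 0) ∧
      ∀ x y : K, ((f (p x).toAdd (p y).toAdd).toMul : K ⧸ ⁅p.ker, (⊤ : Subgroup K)⁆) =
        QuotientGroup.mk' _ ⁅x, y⁆ := by
  set N := ⁅p.ker, (⊤ : Subgroup K)⁆ with hN
  set q := QuotientGroup.mk' N with hq
  have hker : ∀ z, z ∈ N ↔ q z = 1 := fun z => by
    rw [hq, ← MonoidHom.mem_ker, QuotientGroup.ker_mk']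
  have hc : ∀ r ∈ p.ker, ∀ x, q r * q x = q x * q r := fun r hr x => by
    rw [← commutatorElement_eq_one_iff_mul_comm, ← map_commutatorElement, ← hker]
    exact commutator_mem_commutator hr (mem_top x)
  have hcomm : ∀ x y, ⁅x, y⁆ ∈ p.ker := fun x y => by
    rw [MonoidHom.mem_ker, map_commutatorElement, commutatorElement_eq_one_iff_mul_comm, mul_comm]
  have hcen : ∀ x y, q ⁅x, y⁆ ∈ center (K ⧸ N) := fun x y => by
    rw [mem_center_iff]
    intro g
    obtain ⟨g, rfl⟩ := QuotientGroup.mk'_surjective N g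
    exact (hc _ (hcomm x y) g).symm
  have add_left : ∀ x x' y, q ⁅x * x', y⁆ = q ⁅x, y⁆ * q ⁅x', y⁆ := fun x x' y => by
    have h1 : ⁅x * x', y⁆ = x * ⁅x', y⁆ * x⁻¹ * ⁅x, y⁆ := by
      simp only [commutatorElement_def]; group
    rw [h1, map_mul, map_mul, map_mul, ← hc _ (hcomm x' y), ← map_mul, ← map_mul, ← map_mul,
      mul_inv_cancel_right, map_mul, hc _ (hcomm x' y)]
  have inv_symm : ∀ x y, q ⁅x, y⁆ = (q ⁅y, x⁆)⁻¹ := fun x y => by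
    rw [← map_inv, commutatorElement_inv]
  have add_right : ∀ x y y', q ⁅x, y * y'⁆ = q ⁅x, y⁆ * q ⁅x, y'⁆ := fun x y y' => by
    rw [inv_symm, add_left, mul_inv_rev, ← inv_symm, ← inv_symm, hc _ (hcomm x y')]
  have ker_left : ∀ r ∈ p.ker, ∀ y, q ⁅r, y⁆ = 1 := fun r hr y =>
    (hker _).1 (commutator_mem_commutator hr (mem_top y))
  have congr_left : ∀ x x' y, p x = p x' → q ⁅x, y⁆ = q ⁅x', y⁆ := fun x x' y h => by
    have h1 : x * x'⁻¹ ∈ p.ker := by rw [MonoidHom.mem_ker, map_mul, map_inv, h, mul_inv_cancel]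
    rw [← one_mul (q ⁅x', y⁆), ← ker_left _ h1 y, ← add_left, inv_mul_cancel_right]
  have congr_right : ∀ x y y', p y = p y' → q ⁅x, y⁆ = q ⁅x, y'⁆ := fun x y y' h => by
    rw [inv_symm, congr_left _ _ x h, ← inv_symm]
  -- The section `s` is only set-theoretic; `congr_left` and `congr_right` make the form independent
  -- of it.
  choose s hs using fun a : A => hp (Multiplicative.ofAdd a)
  let c : A → A → Additive (center (K ⧸ N)) := fun a b => Additive.ofMul ⟨q ⁅s a, s b⁆, hcen _ _⟩
  have c_ext : ∀ u v : Additive (center (K ⧸ N)), (u.toMul : K ⧸ N) = v.toMul → u = v :=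
    fun u v h => Additive.toMul.injective (Subtype.ext h)
  refine ⟨AddMonoidHom.mk' (fun a => AddMonoidHom.mk' (c a) fun b b' => c_ext _ _ ?_)
    fun a a' => AddMonoidHom.ext fun b => c_ext _ _ ?_, fun a => c_ext _ _ ?_, fun x y => ?_⟩
  · change q ⁅s a, s (b + b')⁆ = q ⁅s a, s b⁆ * q ⁅s a, s b'⁆
    rw [← add_right]
    exact congr_right _ _ _ (by rw [hs, map_mul, hs, hs]; rfl)
  · change q ⁅s (a + a'), s b⁆ = q ⁅s a, s b⁆ * q ⁅s a', s b⁆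
    rw [← add_left]
    exact congr_left _ _ _ (by rw [hs, map_mul, hs, hs]; rfl)
  · change q ⁅s a, s a⁆ = 1
    rw [commutatorElement_self, map_one]
  · change q ⁅s (p x).toAdd, s (p y).toAdd⁆ = q ⁅x, y⁆
    exact (congr_left _ x _ (hs (p x).toAdd)).trans (congr_right _ _ y (hs (p y).toAdd))

open Subgroup in
/-- Hopf's formula for abelian quotients: if `K` is free and `K ⧸ N` is abelian with exterior square
`B`, then `⁅K, K⁆ ⧸ ⁅N, K⁆` is isomorphic to `B`. -/
theorem exists_commutator_hom.{u, v, w} {K : Type u} {A : Type v} {B : Type w} [Group K]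
    [IsFreeGroup K] [AddCommGroup A] [AddCommGroup B] {ω : A →+ A →+ B}
    (hω : IsExteriorSquare.{u} ω) (p : K →* Multiplicative A) (hp : Function.Surjective p) :
    ∃ ψ : commutator K →* Multiplicative B, Function.Surjective ψ ∧
      ψ.ker = ⁅p.ker, (⊤ : Subgroup K)⁆.subgroupOf (commutator K) := by
  let q : FreeAbelianGroup (IsFreeGroup.Generators K) →+ A :=
    FreeAbelianGroup.lift fun i => (p (IsFreeGroup.of i)).toAdd
  obtain ⟨β, hβ⟩ := exists_biadditive_sub_eq hω.alternating q
  -- Freeness of `K` is used here: `Φ` turns `⁅x, y⁆` into an element with fiber `ω (p x) (p y)`.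
  let Φ : K →* CocycleExt β := IsFreeGroup.lift fun i => ⟨.of i, 0⟩
  have hΦ : ∀ x, q (Φ x).base = (p x).toAdd := by
    have e : (AddMonoidHom.toMultiplicative q).comp ((CocycleExt.baseHom β).comp Φ) = p := by
      refine IsFreeGroup.ext_hom fun i => ?_
      simp only [MonoidHom.comp_apply, Φ, IsFreeGroup.lift_of]
      change Multiplicative.ofAdd (q (.of i)) = _
      simp [q]
    intro x
    exact congrArg Multiplicative.toAdd (DFunLike.congr_fun e x)
  have base_zero : ∀ x ∈ commutator K, (Φ x).base = 0 := by
    have : commutator K ≤ ((CocycleExt.baseHom β).comp Φ).ker := by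
      rw [commutator_def, commutator_le]
      intro x _ y _
      rw [MonoidHom.mem_ker, map_commutatorElement, commutatorElement_eq_one_iff_mul_comm, mul_comm]
    exact fun x hx => congrArg Multiplicative.toAdd (MonoidHom.mem_ker.1 (this hx))
  have fiber_comm : ∀ x y, (Φ ⁅x, y⁆).fiber = ω (p x).toAdd (p y).toAdd := fun x y => by
    rw [map_commutatorElement, CocycleExt.commutator_fiber, hβ, hΦ, hΦ]
  -- On `⁅K, K⁆` the base vanishes, so the cocycle term disappears and the fiber is multiplicative.
  let ψ : commutator K →* Multiplicative B :=
    { toFun x := Multiplicative.ofAdd (Φ x).fiber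
      map_one' := by simp
      map_mul' x y := by
        rw [← ofAdd_add]
        simp [base_zero x x.2] }
  refine ⟨ψ, ?_, ?_⟩
  · have hle : AddSubgroup.closure {b | ∃ x y, ω x y = b} ≤ Subgroup.toAddSubgroup' ψ.range := by
      refine (AddSubgroup.closure_le _).2 ?_
      rintro _ ⟨a, b, rfl⟩
      obtain ⟨x, hx⟩ := hp (Multiplicative.ofAdd a)
      obtain ⟨y, hy⟩ := hp (Multiplicative.ofAdd b)
      refine ⟨⟨⁅x, y⁆, commutator_mem_commutator (mem_top x) (mem_top y)⟩, ?_⟩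
      change Multiplicative.ofAdd (Φ ⁅x, y⁆).fiber = _
      rw [fiber_comm, hx, hy]
      rfl
    rw [hω.closure_eq_top] at hle
    exact fun b => hle (AddSubgroup.mem_top b.toAdd)
  · obtain ⟨f, hf, hfp⟩ := exists_commutator_form p hp
    -- The universal property supplies a map back: `g` sends `ψ x` to the class of `x` modulo
    -- `⁅p.ker, K⁆`, so the kernel of `ψ` is no larger than that. Its target lives in the universe
    -- of `K`, the one in which `hω` is assumed.
    obtain ⟨g, hg⟩ := hω.exists_lift _ f hf
    have key : ∀ x ∈ commutator K,
        ((g (Φ x).fiber).toMul : K ⧸ ⁅p.ker, (⊤ : Subgroup K)⁆) = QuotientGroup.mk' _ x := by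
      intro x hx
      rw [commutator_eq_closure] at hx
      induction hx using closure_induction with
      | mem x hx =>
        obtain ⟨x, y, rfl⟩ := hx
        rw [fiber_comm, hg, hfp]
      | one => simp
      | mul x y hx hy ihx ihy =>
        rw [← commutator_eq_closure] at hx
        rw [map_mul, CocycleExt.mul_fiber, base_zero x hx, map_zero, AddMonoidHom.zero_apply,
          add_zero, map_add, toMul_add, coe_mul, ihx, ihy, map_mul]
      | inv x hx ih =>
        rw [← commutator_eq_closure] at hx
        rw [map_inv, CocycleExt.inv_fiber, base_zero x hx, map_zero, add_zero, map_neg,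
          toMul_neg, coe_inv, ih, map_inv]
    ext ⟨x, hx⟩
    rw [MonoidHom.mem_ker, mem_subgroupOf]
    constructor
    · intro h
      have h0 : (Φ x).fiber = 0 := h
      have := key x hx
      rw [h0, map_zero] at this
      rw [← QuotientGroup.ker_mk' ⁅p.ker, (⊤ : Subgroup K)⁆, MonoidHom.mem_ker, ← this]
      rfl
    · intro h
      change (Φ x).fiber = 0
      have hle : ⁅p.ker, (⊤ : Subgroup K)⁆ ≤ Φ.ker := by
        refine commutator_le.2 fun r hr y _ => ?_
        rw [MonoidHom.mem_ker]
        ext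
        · rw [map_commutatorElement, CocycleExt.commutator_base]; rfl
        · rw [fiber_comm, MonoidHom.mem_ker.1 hr]; simp
      have := MonoidHom.mem_ker.1 (hle h)
      rw [this]
      rfl

/-! ### The exterior square of a product of cyclic groups; increasing pairs are again linearly
ordered, so it can be iterated -/

/-- The strictly increasing pairs of a linear order, ordered lexicographically. -/
abbrev IncreasingPair (ι : Type*) [LT ι] : Type _ := {p : ι ×ₗ ι // (ofLex p).1 < (ofLex p).2}

namespace IncreasingPair

variable {ι : Type*} [LT ι]

/-- The smaller entry of a pair. -/
def fst (p : IncreasingPair ι) : ι := (ofLex p.1).1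
/-- The larger entry of a pair. -/
def snd (p : IncreasingPair ι) : ι := (ofLex p.1).2
/-- The pair with given entries. -/
def mk (i j : ι) (h : i < j) : IncreasingPair ι := ⟨toLex (i, j), h⟩

theorem fst_lt_snd (p : IncreasingPair ι) : p.fst < p.snd := p.2

@[ext]
theorem ext {p q : IncreasingPair ι} (h₁ : p.fst = q.fst) (h₂ : p.snd = q.snd) : p = q :=
  Subtype.ext (ofLex.injective (Prod.ext h₁ h₂))

@[simp] theorem fst_mk (i j : ι) (h : i < j) : (mk i j h).fst = i := rfl
@[simp] theorem snd_mk (i j : ι) (h : i < j) : (mk i j h).snd = j := rfl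

end IncreasingPair

section

variable {ι : Type*} [LinearOrder ι] (a : ι → ℕ)

/-- The order of the component of the exterior square of `∏ ZMod (a i)` at a pair of indices. -/
def pairGcd (p : IncreasingPair ι) : ℕ := Nat.gcd (a p.fst) (a p.snd)

/-- The reduction of the smaller component. -/
def redFst (p : IncreasingPair ι) : ZMod (a p.fst) →+* ZMod (pairGcd a p) :=
  ZMod.castHom (Nat.gcd_dvd_left _ _) _

/-- The reduction of the larger component. -/
def redSnd (p : IncreasingPair ι) : ZMod (a p.snd) →+* ZMod (pairGcd a p) :=
  ZMod.castHom (Nat.gcd_dvd_right _ _) _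

/-- The family of `2 × 2` minors of a pair of vectors. -/
def wedge : ((i : ι) → ZMod (a i)) →+ ((i : ι) → ZMod (a i)) →+
    ((p : IncreasingPair ι) → ZMod (pairGcd a p)) :=
  AddMonoidHom.mk' (fun x => AddMonoidHom.mk' (fun y p =>
      redFst a p (x p.fst) * redSnd a p (y p.snd) - redFst a p (y p.fst) * redSnd a p (x p.snd))
    fun y y' => by ext p; simp only [Pi.add_apply, map_add]; ring)
    fun x x' => by
      ext y p
      simp only [Pi.add_apply, map_add, AddMonoidHom.mk'_apply, AddMonoidHom.add_apply]; ring

theorem wedge_apply (x y : (i : ι) → ZMod (a i)) (p : IncreasingPair ι) :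
    wedge a x y p =
      redFst a p (x p.fst) * redSnd a p (y p.snd) - redFst a p (y p.fst) * redSnd a p (x p.snd) :=
  rfl

theorem wedge_single (i j : ι) (h : i < j) :
    wedge a (Pi.single i 1) (Pi.single j 1) = Pi.single (IncreasingPair.mk i j h) 1 := by
  ext p
  rw [wedge_apply]
  by_cases hp : p = IncreasingPair.mk i j h
  · subst hp
    have h1 : (Pi.single i 1 : (i : ι) → ZMod (a i)) (IncreasingPair.mk i j h).fst = 1 :=
      Pi.single_eq_same _ _
    have h2 : (Pi.single i 1 : (i : ι) → ZMod (a i)) (IncreasingPair.mk i j h).snd = 0 :=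
      Pi.single_eq_of_ne h.ne' _
    have h3 : (Pi.single j 1 : (i : ι) → ZMod (a i)) (IncreasingPair.mk i j h).snd = 1 :=
      Pi.single_eq_same _ _
    rw [h1, h2, h3, map_one, map_one, map_zero, mul_zero, sub_zero, mul_one, Pi.single_eq_same]
  · rw [Pi.single_eq_of_ne hp]
    have e1 : redFst a p ((Pi.single i 1 : (i : ι) → ZMod (a i)) p.fst) *
        redSnd a p ((Pi.single j 1 : (i : ι) → ZMod (a i)) p.snd) = 0 := by
      by_cases h1 : p.fst = i
      · have h2 : p.snd ≠ j := fun h2 => hp (IncreasingPair.ext h1 h2)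
        rw [Pi.single_eq_of_ne h2, map_zero, mul_zero]
      · rw [Pi.single_eq_of_ne h1, map_zero, zero_mul]
    have e2 : redFst a p ((Pi.single j 1 : (i : ι) → ZMod (a i)) p.fst) *
        redSnd a p ((Pi.single i 1 : (i : ι) → ZMod (a i)) p.snd) = 0 := by
      by_cases h1 : p.fst = j
      · have h2 : p.snd ≠ i := fun h2 => (p.fst_lt_snd.trans (h2 ▸ h)).ne h1
        rw [Pi.single_eq_of_ne h2, map_zero, mul_zero]
      · rw [Pi.single_eq_of_ne h1, map_zero, zero_mul]
    rw [e1, e2, sub_zero]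

theorem wedge_self (x : (i : ι) → ZMod (a i)) : wedge a x x = 0 := by
  ext p
  rw [wedge_apply, sub_self]
  rfl

theorem piZMod_single_eq_zsmul {κ : Type*} [DecidableEq κ] (a : κ → ℕ) (i : κ) (x : ZMod (a i)) :
    ∃ z : ℤ, (Pi.single i x : (i : κ) → ZMod (a i)) = z • Pi.single i 1 := by
  obtain ⟨z, rfl⟩ := ZMod.intCast_surjective x
  refine ⟨z, ?_⟩
  rw [← Pi.single_smul, zsmul_one]

theorem piZMod_hom_ext {κ C : Type*} [DecidableEq κ] [Finite κ] [AddCommGroup C] {a : κ → ℕ}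
    {f g : ((i : κ) → ZMod (a i)) →+ C} (h : ∀ i, f (Pi.single i 1) = g (Pi.single i 1)) :
    f = g := by
  refine AddMonoidHom.functions_ext _ _ _ fun i x => ?_
  obtain ⟨z, hz⟩ := piZMod_single_eq_zsmul a i x
  rw [hz, map_zsmul, map_zsmul, h]

/-- Homomorphisms out of a finite product of cyclic groups. -/
theorem exists_piZMod_hom {κ C : Type*} [DecidableEq κ] [Fintype κ] [AddCommGroup C] (a : κ → ℕ)
    (c : κ → C) (hc : ∀ i, a i • c i = 0) :
    ∃ g : ((i : κ) → ZMod (a i)) →+ C, ∀ i, g (Pi.single i 1) = c i := by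
  let l : (i : κ) → ZMod (a i) →+ C := fun i =>
    ZMod.lift (a i) ⟨zmultiplesHom C (c i), by simpa using hc i⟩
  refine ⟨∑ i, (l i).comp (Pi.evalAddMonoidHom _ i), fun i => ?_⟩
  rw [AddMonoidHom.finsetSum_apply, Finset.sum_eq_single i]
  · have h1 := ZMod.lift_coe (a i) ⟨zmultiplesHom C (c i), by simpa using hc i⟩ (1 : ℤ)
    simpa [l] using h1
  · intro j _ hj
    simp [Pi.single_eq_of_ne hj]
  · simp

theorem isExteriorSquare_wedge.{u} [Fintype ι] : IsExteriorSquare.{u} (wedge a) where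
  alternating := wedge_self a
  closure_eq_top := by
    rw [eq_top_iff]
    intro b _
    have : Fintype (IncreasingPair ι) := Fintype.ofFinite _
    rw [← Finset.univ_sum_single b]
    refine sum_mem fun p _ => ?_
    obtain ⟨z, hz⟩ := piZMod_single_eq_zsmul (pairGcd a) p (b p)
    have hp : (Pi.single p 1 : (p : IncreasingPair ι) → ZMod (pairGcd a p)) ∈
        {b | ∃ x y, wedge a x y = b} := ⟨_, _, wedge_single a p.fst p.snd p.2⟩
    rw [hz]
    exact zsmul_mem (AddSubgroup.subset_closure hp) z
  exists_lift C _ f hf := by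
    have : Fintype (IncreasingPair ι) := Fintype.ofFinite _
    have hzero : ∀ i, a i • (Pi.single i 1 : (i : ι) → ZMod (a i)) = 0 := fun i => by
      rw [← Pi.single_smul, nsmul_one, ZMod.natCast_self, Pi.single_zero]
    obtain ⟨g, hg⟩ := exists_piZMod_hom (pairGcd a)
      (fun p => f (Pi.single p.fst 1) (Pi.single p.snd 1)) fun p => by
        rw [← addOrderOf_dvd_iff_nsmul_eq_zero]
        -- By biadditivity the value is killed by the order of either argument, hence by their gcd.
        refine Nat.dvd_gcd ?_ ?_
        · rw [addOrderOf_dvd_iff_nsmul_eq_zero, ← AddMonoidHom.nsmul_apply, ← map_nsmul, hzero,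
            map_zero, AddMonoidHom.zero_apply]
        · rw [addOrderOf_dvd_iff_nsmul_eq_zero, ← map_nsmul, hzero, map_zero]
    refine ⟨g, fun x y => ?_⟩
    have e : (wedge a).compr₂ g = f := by
      refine piZMod_hom_ext fun i => piZMod_hom_ext fun j => ?_
      rw [AddMonoidHom.compr₂_apply]
      rcases lt_trichotomy i j with h | rfl | h
      · rw [wedge_single a i j h, hg]; rfl
      · rw [wedge_self, map_zero, hf]
      · rw [alternating_swap (wedge_self a), alternating_swap hf, wedge_single a j i h, map_neg, hg]
        rfl
    exact DFunLike.congr_fun (DFunLike.congr_fun e x) y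

end

/-! ### Counting pairs and basic commutators of weight two -/

theorem wittNumber_two (d : ℕ) : wittNumber 2 d = d.choose 2 := by
  have h1 : (2 : ℕ).divisors = {1, 2} := by decide
  have h2 : ArithmeticFunction.moebius 2 = -1 :=
    ArithmeticFunction.moebius_apply_prime Nat.prime_two
  have h3 : (d : ℤ) ^ 2 + -(d : ℤ) = ((d * (d - 1) : ℕ) : ℤ) := by
    cases d with
    | zero => simp
    | succ d => push_cast [Nat.add_sub_cancel]; ring
  have h4 : wittNumber 2 d = (((d * (d - 1) : ℕ) : ℤ) / ((2 : ℕ) : ℤ)).toNat := by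
    unfold wittNumber
    rw [h1, Finset.sum_pair (by norm_num), h2, ← h3]
    simp
  rw [h4, ← Int.natCast_div, Int.toNat_natCast, Nat.choose_two_right]

theorem card_increasing_pairs {ι : Type*} [LinearOrder ι] [Finite ι] (S : ι → Prop) :
    Nat.card {p : IncreasingPair ι // S p.fst ∧ S p.snd} = (Nat.card {i // S i}).choose 2 := by
  classical
  have : Fintype ι := Fintype.ofFinite ι
  let s : Finset ι := {i | S i}
  have hs : Nat.card {i // S i} = s.card := Nat.subtype_card s (by simp [s])
  rw [hs, ← Finset.card_product_filter_lt]
  let e : {p : IncreasingPair ι // S p.fst ∧ S p.snd} ≃ {x ∈ s ×ˢ s | x.1 < x.2} :=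
    { toFun p := ⟨(p.1.fst, p.1.snd), by simpa [s] using ⟨p.2, p.1.fst_lt_snd⟩⟩
      invFun x := ⟨IncreasingPair.mk x.1.1 x.1.2 (Finset.mem_filter.1 x.2).2, by
        simpa [s] using (Finset.mem_filter.1 x.2).1⟩
      left_inv _ := rfl
      right_inv _ := rfl }
  rw [Nat.card_congr e, Nat.card_eq_fintype_card, Fintype.card_coe]

theorem numBasicComm_two (d : ℕ) : numBasicComm 2 d = d.choose 2 := by
  let c : IncreasingPair (Fin d) → {w : FreeMagma (Fin d) // IsBasicComm w ∧ w.length = 2} :=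
    fun p => ⟨.mul (.of p.snd) (.of p.fst),
      ⟨trivial, trivial, p.fst_lt_snd, fun _ _ h => by cases h⟩, rfl⟩
  have hc : Function.Bijective c := by
    constructor
    · intro p q h
      have h1 := congrArg Subtype.val h
      injection h1 with h2 h3
      injection h2 with h2
      injection h3 with h3
      exact IncreasingPair.ext h3 h2
    -- Length two forces a product of two letters, and the order condition then says that the second
    -- is smaller.
    · rintro ⟨w, hw, hl⟩
      match w, hw, hl with
      | .of _, _, hl => simp [FreeMagma.length] at hl
      | .mul (.mul x y) z, _, hl =>
        have := x.length_pos
        have := y.length_pos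
        have := z.length_pos
        simp only [FreeMagma.length] at hl
        omega
      | .mul (.of _) (.mul y z), _, hl =>
        have := y.length_pos
        have := z.length_pos
        simp only [FreeMagma.length] at hl
        omega
      | .mul (.of b) (.of a), hw, _ => exact ⟨IncreasingPair.mk a b hw.2.2.1, rfl⟩
  have h := card_increasing_pairs fun _ : Fin d => True
  have e := Nat.card_congr (Equiv.subtypeUnivEquiv (α := IncreasingPair (Fin d))
    (p := fun _ => True ∧ True) fun _ => ⟨trivial, trivial⟩)
  unfold numBasicComm
  rw [← Nat.card_congr (Equiv.ofBijective c hc), ← e, h]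
  simp

/-- Two maps from finite types whose fibres have the same sizes differ by a bijection. -/
theorem exists_equiv_of_card_fiber_eq {S T L : Type*} [Finite S] [Finite T] (f : S → L) (g : T → L)
    (h : ∀ y, Nat.card {x // f x = y} = Nat.card {x // g x = y}) :
    ∃ σ : S ≃ T, ∀ x, g (σ x) = f x := by
  let e : ∀ y, {x // f x = y} ≃ {x // g x = y} := fun y => (Finite.card_eq.1 (h y)).some
  refine ⟨(Equiv.sigmaFiberEquiv f).symm.trans ((Equiv.sigmaCongrRight e).trans
    (Equiv.sigmaFiberEquiv g)), fun x => ?_⟩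
  exact (e (f x) ⟨x, rfl⟩).2

/-! ### Divisibility chains and levels -/

/-- The orders of the cyclic summands, extended by `1` beyond the last one. -/
def chain (m : ℕ) {k : ℕ} (n : Fin k → ℕ) (t : ℕ) : ℕ :=
  if t < m then 0 else if h : t - m < k then n ⟨t - m, h⟩ else 1

theorem chain_of_lt {m k : ℕ} (n : Fin k → ℕ) {t : ℕ} (h : t < m) : chain m n t = 0 := if_pos h

theorem chain_dvd {m k : ℕ} {n : Fin k → ℕ}
    (hn : ∀ i j : Fin k, (i : ℕ) + 1 = (j : ℕ) → n j ∣ n i) {s t : ℕ} (h : s ≤ t) :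
    chain m n t ∣ chain m n s := by
  induction t, h using Nat.le_induction with
  | base => rfl
  | succ t _ ih =>
    refine dvd_trans ?_ ih
    by_cases h1 : t < m
    · rw [chain_of_lt n h1]; exact dvd_zero _
    by_cases h2 : t + 1 - m < k
    · have e1 : chain m n t = n ⟨t - m, by omega⟩ := by
        rw [chain, if_neg h1, dif_pos]
      have e2 : chain m n (t + 1) = n ⟨t + 1 - m, h2⟩ := by
        rw [chain, if_neg (by omega), dif_pos]
      rw [e1, e2]
      exact hn _ _ (by simp only []; omega)
    · have e2 : chain m n (t + 1) = 1 := by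
        rw [chain, if_neg (by omega), dif_neg h2]
      rw [e2]; exact one_dvd _

theorem chain_gcd {m k : ℕ} {n : Fin k → ℕ}
    (hn : ∀ i j : Fin k, (i : ℕ) + 1 = (j : ℕ) → n j ∣ n i) (s t : ℕ) :
    Nat.gcd (chain m n s) (chain m n t) = chain m n (max s t) := by
  rcases le_total s t with h | h
  · rw [max_eq_right h, Nat.gcd_eq_right (chain_dvd hn h)]
  · rw [max_eq_left h, Nat.gcd_eq_left (chain_dvd hn h)]

/-- The larger of the levels of the two entries of a pair. -/
def pairLevel {ι : Type*} [LT ι] (l : ι → ℕ) (p : IncreasingPair ι) : ℕ := max (l p.fst) (l p.snd)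

/-- The exterior square of a product indexed by levels has the same shape, with levels `pairLevel
l`; this is what lets the computation be repeated. -/
theorem pairGcd_chain {m k : ℕ} {n : Fin k → ℕ}
    (hn : ∀ i j : Fin k, (i : ℕ) + 1 = (j : ℕ) → n j ∣ n i) {ι : Type*} [LinearOrder ι]
    (l : ι → ℕ) : pairGcd (fun i => chain m n (l i)) = fun p => chain m n (pairLevel l p) :=
  funext fun _ => chain_gcd hn _ _

/-- A maximum is below `t` exactly when both entries are, so cumulative counts, unlike counts at a
single level, transform by `choose 2`. -/
theorem card_pairLevel_lt {ι : Type*} [LinearOrder ι] [Finite ι] (l : ι → ℕ) (t : ℕ) :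
    Nat.card {p // pairLevel l p < t} = (Nat.card {i // l i < t}).choose 2 := by
  rw [← card_increasing_pairs]
  exact Nat.card_congr (Equiv.subtypeEquivRight fun p => max_lt_iff)

theorem card_level_eq {T : Type*} [Finite T] (l : T → ℕ) (t : ℕ) :
    Nat.card {x // l x = t} = Nat.card {x // l x < t + 1} - Nat.card {x // l x < t} := by
  classical
  have := Fintype.ofFinite T
  simp only [Nat.card_eq_fintype_card, Fintype.card_subtype]
  have h : (Finset.univ.filter fun x => l x < t + 1) =
      (Finset.univ.filter fun x => l x < t).disjUnion (Finset.univ.filter fun x => l x = t)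
        (Finset.disjoint_filter.2 fun x _ h => h.ne) := by
    ext x; simp [le_iff_lt_or_eq]
  rw [h, Finset.card_disjUnion, Nat.add_sub_cancel_left]

/-- Collecting the factors of a product of cyclic groups by level. -/
theorem exists_piZMod_chain_equiv {m k : ℕ} (n : Fin k → ℕ) {T S : Type*} {E : Fin k → Type*}
    [Finite T] [Finite S] [∀ j, Finite (E j)] (l : T → ℕ) (hl : ∀ x, l x < m + k)
    (hS : Nat.card S = Nat.card {x // l x < m})
    (hE : ∀ j : Fin k, Nat.card (E j) = Nat.card {x // l x = m + j}) :
    Nonempty (((x : T) → ZMod (chain m n (l x))) ≃+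
      (S → ℤ) × ((j : Fin k) → E j → ZMod (n j))) := by
  classical
  have := Fintype.ofFinite S
  have := fun j => Fintype.ofFinite (E j)
  -- All levels below `m` carry order `0` and are merged into `none`; level `m + j` becomes `some
  -- j`.
  let f : T → Option (Fin k) := fun x =>
    if h : l x < m then none else some ⟨l x - m, by have := hl x; omega⟩
  let g : S ⊕ (Σ j, E j) → Option (Fin k) := Sum.elim (fun _ => none) (fun y => some y.1)
  have hf : ∀ x, (Option.elim (f x) 0 n) = chain m n (l x) := fun x => by
    by_cases h : l x < m
    · simp [f, h, chain]
    · have := hl x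
      have h2 : l x - m < k := by omega
      simp [f, h, chain, h2]
  obtain ⟨σ, hσ⟩ := exists_equiv_of_card_fiber_eq f g (by
    rintro (_ | j)
    · have e1 : Nat.card {x // f x = none} = Nat.card {x // l x < m} :=
        Nat.card_congr (Equiv.subtypeEquivRight fun x => by
          by_cases h : l x < m <;> simp [f, h])
      rw [e1, ← hS, Nat.card_eq_fintype_card, Nat.card_eq_fintype_card, Fintype.card_subtype,
        Finset.card_filter, Fintype.sum_sum_type]
      simp [g]
    · have e1 : Nat.card {x // f x = some j} = Nat.card {x // l x = m + j} :=
        Nat.card_congr (Equiv.subtypeEquivRight fun x => by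
          by_cases h : l x < m
          · simp only [f, h, dite_true, reduceCtorEq, false_iff]; omega
          · simp only [f, h, dite_false, Option.some.injEq, Fin.ext_iff]; omega)
      rw [e1, ← hE, Nat.card_eq_fintype_card, Nat.card_eq_fintype_card, Fintype.card_subtype,
        Finset.card_filter, Fintype.sum_sum_type, Fintype.sum_sigma]
      simp [g])
  let b : S ⊕ (Σ j, E j) → ℕ := fun y => Option.elim (g y) 0 n
  have hb : (fun x => chain m n (l x)) = fun x => b (σ x) := by
    funext x; rw [← hf, ← hσ]
  -- The family of orders is generalized so that the equality can be substituted inside the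
  -- dependent product.
  suffices h : ∀ c : T → ℕ, (c = fun x => b (σ x)) →
      Nonempty (((x : T) → ZMod (c x)) ≃+ (S → ℤ) × ((j : Fin k) → E j → ZMod (n j))) from h _ hb
  rintro _ rfl
  let e1 := (LinearEquiv.piCongrLeft ℤ (fun y => ZMod (b y)) σ).toAddEquiv
  let e2 := (LinearEquiv.sumPiEquivProdPi ℤ S (Σ j, E j) (fun y => ZMod (b y))).toAddEquiv
  -- `ZMod 0` is `ℤ` by definition.
  let e3 : (S → ZMod 0) ≃+ (S → ℤ) := AddEquiv.refl (S → ℤ)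
  let e4 := (LinearEquiv.piCurry ℤ (κ := E) (fun j _ => ZMod (n j))).toAddEquiv
  exact ⟨(e1.trans e2).trans (AddEquiv.prodCongr e3 e4)⟩

/-! ### The multiplier as an iterated exterior square -/

open Subgroup in
/-- The metabelian multiplier of an abelian group is the exterior square of its exterior square. -/
theorem nonempty_baerInvariant_equiv.{u, v, w, w'} {F : Type u} {A : Type v} {B : Type w}
    {C : Type w'} {G : Type*} [Group F] [IsFreeGroup F] [Group G] [AddCommGroup A] [AddCommGroup B]
    [AddCommGroup C] {ω : A →+ A →+ B} {ω' : B →+ B →+ C} (hω : IsExteriorSquare.{u} ω)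
    (hω' : IsExteriorSquare.{u} ω') (e : G ≃* Multiplicative A) (π : F →* G)
    (hπ : Function.Surjective π) :
    Nonempty (BaerInvariant (solvableWords 2) π ≃* Multiplicative C) := by
  obtain ⟨ψ, hψ, kerψ⟩ := exists_commutator_hom hω (e.toMonoidHom.comp π) (e.surjective.comp hπ)
  -- Hopf's formula for `F'` itself, which is free as a subgroup of a free group.
  obtain ⟨χ, hχ, kerχ⟩ := exists_commutator_hom hω' ψ hψ
  have kerπ : (e.toMonoidHom.comp π).ker = π.ker := by
    ext x
    simp [MonoidHom.mem_ker]
  rw [kerπ] at kerψ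
  have hR : commutator F ≤ π.ker := by
    rw [← kerπ, commutator_def, commutator_le]
    intro x _ y _
    rw [MonoidHom.mem_ker, map_commutatorElement, commutatorElement_eq_one_iff_mul_comm, mul_comm]
  have map_top : (⊤ : Subgroup (commutator F)).map (commutator F).subtype = commutator F := by
    rw [← MonoidHom.range_eq_map, range_subtype]
  have num : (commutator (commutator F)).map (commutator F).subtype =
      π.ker ⊓ verbalSubgroup (solvableWords 2) F := by
    rw [verbalSubgroup_solvableWords_two, _root_.commutator_def (commutator F), map_commutator,
      map_top, inf_eq_right.2]
    exact (commutator_mono le_top le_top).trans hR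
  have den : (⁅ψ.ker, (⊤ : Subgroup (commutator F))⁆).map (commutator F).subtype =
      starSubgroup (solvableWords 2) π.ker := by
    rw [starSubgroup_solvableWords_two, map_commutator, map_top, kerψ, map_subgroupOf_eq_of_le]
    exact commutator_mono le_top le_rfl
  let ε : commutator (commutator F) ≃* ↥(π.ker ⊓ verbalSubgroup (solvableWords 2) F) :=
    ((commutator (commutator F)).equivMapOfInjective _ (commutator F).subtype_injective).trans
      (MulEquiv.subgroupCongr num)
  let θ : ↥(π.ker ⊓ verbalSubgroup (solvableWords 2) F) →* Multiplicative C :=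
    χ.comp ε.symm.toMonoidHom
  have hθ : Function.Surjective θ := hχ.comp ε.symm.surjective
  have kerθ : (starSubgroup (solvableWords 2) π.ker).subgroupOf
      (π.ker ⊓ verbalSubgroup (solvableWords 2) F) = θ.ker := by
    ext z
    obtain ⟨y, rfl⟩ := ε.surjective z
    have h1 : θ (ε y) = χ y := congrArg χ (ε.symm_apply_apply y)
    have h2 : ((ε y : ↥(π.ker ⊓ verbalSubgroup (solvableWords 2) F)) : F) =
        (commutator F).subtype y := rfl
    rw [MonoidHom.mem_ker, h1, ← MonoidHom.mem_ker, kerχ, mem_subgroupOf, mem_subgroupOf, h2, ← den,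
      mem_map_iff_mem (commutator F).subtype_injective]
  exact ⟨(QuotientGroup.quotientMulEquivOfEq kerθ).trans
    (QuotientGroup.quotientKerEquivOfSurjective θ hθ)⟩

theorem theorem2p1 (m k : ℕ) (n : Fin k → ℕ)
    (hn : ∀ i j : Fin k, (i : ℕ) + 1 = (j : ℕ) → n j ∣ n i)
    {G : Type*} [Group G]
    (e : G ≃* Multiplicative ((Fin m → ℤ) × ((j : Fin k) → ZMod (n j))))
    {F : Type*} [Group F] [IsFreeGroup F] (π : F →* G) (hπ : Function.Surjective π) :
    (∀ i : ℕ, wittNumber 2 i = numBasicComm 2 i) ∧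
    Nonempty (BaerInvariant (solvableWords 2) π ≃*
      Multiplicative ((Fin (dNumber m) → ℤ) ×
        ((j : Fin k) → Fin (dNumber (m + (j : ℕ) + 1) - dNumber (m + (j : ℕ))) →
          ZMod (n j)))) := by
  refine ⟨fun i => by rw [wittNumber_two, numBasicComm_two], ?_⟩
  -- Each of the `m + k` cyclic summands of `G` is its own level, infinite ones first, so exactly
  -- `t` of them lie below level `t`.
  let l₀ : Fin (m + k) → ℕ := fun i => i
  let l₂ := pairLevel (pairLevel l₀)
  have count₀ : ∀ t ≤ m + k, Nat.card {i // l₀ i < t} = t := fun t ht => by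
    rw [Nat.card_congr (Fin.castLEquiv ht).symm, Nat.card_fin]
  have count₂ : ∀ t ≤ m + k, Nat.card {p // l₂ p < t} = dNumber t := fun t ht => by
    rw [card_pairLevel_lt, card_pairLevel_lt, count₀ t ht, dNumber, wittNumber_two, wittNumber_two]
  have hl₀ : ∀ i, l₀ i < m + k := fun i => i.2
  have hl₂ : ∀ p, l₂ p < m + k := fun p =>
    max_lt (max_lt (hl₀ _) (hl₀ _)) (max_lt (hl₀ _) (hl₀ _))
  obtain ⟨e₀⟩ := exists_piZMod_chain_equiv n (S := Fin m) (E := fun _ => Unit) l₀ hl₀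
    (by rw [count₀ m (by omega), Nat.card_fin])
    fun j => by
      rw [card_level_eq, count₀ _ (by omega), count₀ _ (by omega), Nat.card_unique]; omega
  obtain ⟨e₂⟩ := exists_piZMod_chain_equiv n (S := Fin (dNumber m))
    (E := fun j => Fin (dNumber (m + (j : ℕ) + 1) - dNumber (m + (j : ℕ)))) l₂ hl₂
    (by rw [count₂ m (by omega), Nat.card_fin])
    -- With `j` counted from zero, the factors of order `n j` are those of level exactly `m + j`:
    -- the difference of the cumulative counts at `m + j + 1` and `m + j`.
    fun j => by
      rw [card_level_eq, count₂ _ (by omega), count₂ _ (by omega), Nat.card_fin]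
  let u : ((Fin m → ℤ) × ((j : Fin k) → Unit → ZMod (n j))) ≃+
      ((Fin m → ℤ) × ((j : Fin k) → ZMod (n j))) :=
    AddEquiv.prodCongr (AddEquiv.refl _)
      (AddEquiv.piCongrRight fun j => (LinearEquiv.funUnique Unit ℤ (ZMod (n j))).toAddEquiv)
  have hω' := isExteriorSquare_wedge (pairGcd fun i => chain m n (l₀ i))
  obtain ⟨f⟩ := nonempty_baerInvariant_equiv (isExteriorSquare_wedge fun i => chain m n (l₀ i)) hω'
    (e.trans (AddEquiv.toMultiplicative (e₀.trans u).symm)) π hπ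
  have hgcd : pairGcd (pairGcd fun i => chain m n (l₀ i)) = fun p => chain m n (l₂ p) := by
    rw [pairGcd_chain hn, pairGcd_chain hn]
  suffices h : ∀ c : IncreasingPair (IncreasingPair (Fin (m + k))) → ℕ,
      (c = fun p => chain m n (l₂ p)) → Nonempty (((p : _) → ZMod (c p)) ≃+ _) from
    let ⟨g⟩ := h _ hgcd
    ⟨f.trans (AddEquiv.toMultiplicative g)⟩
  rintro _ rfl
  exact ⟨e₂⟩
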